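/- **Theorem 4.1 (Subderivative-subdifferential duality formula).** Let $X$ be a real Banach space with topological dual $X^*$. All functions $f:X\to\,]-\infty,+\infty]$ below are assumed lower semicontinuous and proper, i.e. $\operatorname{dom} f:=\{x: f(x)<\infty\}\neq\emptyset$. For $x\in\operatorname{dom} f$ and $u\in X$ put $$f^r(x;u):=\liminf_{t\searrow 0}\frac{f(x+tu)-f(x)}{t},\qquad f^d(x;u):=\liminf_{t\searrow 0,\;u'\to u}\frac{f(x+tu')-f(x)}{t},$$ $$f^\uparrow(x;u):=\sup_{\delta>0}\ \limsup_{t\searrow 0,\;(y,f(y))\to(x,f(x))}\ \inf_{\|u'-u\|\le\delta}\frac{f(y+tu')-f(y)}{t},$$ $$\partial_{MR}f(x):=\{x^*\in X^*:\langle x^*,y-x\rangle+f(x)\le f(y)\ \ \forall y\in X\},\qquad \partial_Cf(x):=\{x^*\in X^*:\langle x^*,u\rangle\le f^\uparrow(x;u)\ \ \forall u\in X\},$$ and let $\partial_{MR}f(x)=\partial_Cf(x)=\emptyset$ for $x\notin\operatorname{dom}f$. A *subdifferential* on $X$ is an operator $\partial$ that associates to each function $f$ on $X$ a set-valued map $\partial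 f:X\rightrightarrows X^*$ such that $\partial_{MR}f(x)\subset\partial f(x)\subset\partial_Cf(x)$ for all $x$, and such that the *Separation Principle* holds: for all $f$ and all convex $\varphi$ and every $\bar z\in\operatorname{dom}f$ such that $\varphi$ is (finite and) Lipschitz near $\bar z$, if $f+\varphi$ has a local minimum at $\bar z$, then $0\in\widehat\partial f(\bar z)+\partial\varphi(\bar z)$. Here $\widehat\partial f(\bar z)$ is the set of all $\bar z^*\in X^*$ for which there is a net $(x_\nu,x^*_\nu)_\nu$ with $x^*_\nu\in\partial f(x_\nu)$, $(x_\nu,f(x_\nu))\to(\bar z,f(\bar z))$, $x^*_\nu\to\bar z^*$ weak$^*$, and $\limsup_\nu\langle x^*_\nu,x_\nu-\bar z\rangle\le 0$. Write $f^\partial(x;u):=\sup\{\langle x^*,u\rangle:x^*\in\partial f(x)\}$, with $\sup\emptyset=-\infty$. For $\bar x,v\in X$ and a function $F:\operatorname{dom} f\to[-\infty,+\infty]$ let $$\limsup_{x\to_v\bar x}F(x):=\inf_{\varepsilon>0}\ \sup\{F(x): x\in\operatorname{dom}f,\ x=\bar x+tv',\ 0<t<\varepsilon,\ \|v'-v\|<\varepsilon\}.$$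 Let $\partial$ be a subdifferential on $X$, let $f$ be a proper lower semicontinuous function as above, and let $f':\operatorname{dom}f\times X\to[-\infty,+\infty]$ be any function with $f^d\le f'\le f^\uparrow$ on $\operatorname{dom}f\times X$. Then for every $\bar x\in\operatorname{dom}f$, all $u,v\in X$ and every real $\alpha\ge 0$, $$\limsup_{x\to_v\bar x}f^r(x;u+\alpha(\bar x-x))=\limsup_{x\to_v\bar x}f'(x;u+\alpha(\bar x-x))=\limsup_{x\to_v\bar x}f^\partial(x;u+\alpha(\bar x-x)).$$ -/

import Mathlib

open Filter Topology

universe u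

noncomputable section

/-- The effective domain `dom f = {x | f x < ∞}`. -/
def effDom {X : Type u} (f : X → EReal) : Set X :=
  {x | f x < ⊤}

/-- A proper lower semicontinuous function with values in `]-∞, +∞]`. -/
structure IsProperLsc {X : Type u} [TopologicalSpace X] (f : X → EReal) : Prop where
  ne_bot : ∀ x, f x ≠ ⊥
  nonempty : (effDom f).Nonempty
  lsc : LowerSemicontinuous f

/-- The difference quotient `(f (x + t u) - f x) / t`; it is only used for `t > 0` and finite
`f x`, where the extended-real operations involve no convention. -/
def diffQuot {X : Type u} [NormedAddCommGroup X] [NormedSpace ℝ X]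
    (f : X → EReal) (x : X) (t : ℝ) (u : X) : EReal :=
  (f (x + t • u) - f x) / (t : EReal)

/-- The (lower right Dini) radial subderivative
`f^r(x; u) = liminf_{t ↘ 0} (f (x + t u) - f x) / t`. -/
def radialSubderiv {X : Type u} [NormedAddCommGroup X] [NormedSpace ℝ X]
    (f : X → EReal) (x u : X) : EReal :=
  liminf (fun t : ℝ => diffQuot f x t u) (𝓝[>] 0)

/-- The (lower right Dini-Hadamard) directional subderivative
`f^d(x; u) = liminf_{t ↘ 0, u' → u} (f (x + t u') - f x) / t`. -/
def directionalSubderiv {X : Type u} [NormedAddCommGroup X] [NormedSpace ℝ X]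
    (f : X → EReal) (x u : X) : EReal :=
  liminf (fun p : ℝ × X => diffQuot f x p.1 p.2) (𝓝[>] 0 ×ˢ 𝓝 u)

/-- The filter `(y, f y) → (x, f x)`. -/
def graphNhds {X : Type u} [TopologicalSpace X] (f : X → EReal) (x : X) : Filter X :=
  comap (fun y => (y, f y)) (𝓝 (x, f x))

/-- The Clarke-Rockafellar subderivative
`f^↑(x; u) = sup_{δ > 0} limsup_{t ↘ 0, (y, f y) → (x, f x)} inf_{u' ∈ B_δ(u)}
(f (y + t u') - f y) / t`. -/
def clarkeRockafellarSubderiv {X : Type u} [NormedAddCommGroup X] [NormedSpace ℝ X]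
    (f : X → EReal) (x u : X) : EReal :=
  ⨆ (δ : ℝ) (_ : 0 < δ),
    limsup (fun p : ℝ × X => ⨅ u' ∈ Metric.closedBall u δ, diffQuot f p.2 p.1 u')
      (𝓝[>] 0 ×ˢ graphNhds f x)

/-- The Moreau-Rockafellar subdifferential (empty outside the domain). -/
def moreauRockafellarSubdiff {X : Type u} [NormedAddCommGroup X] [NormedSpace ℝ X]
    (f : X → EReal) (x : X) : Set (X →L[ℝ] ℝ) :=
  {xs | x ∈ effDom f ∧ ∀ y, ((xs (y - x) : ℝ) : EReal) + f x ≤ f y}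

/-- The Clarke subdifferential (empty outside the domain). -/
def clarkeSubdiff {X : Type u} [NormedAddCommGroup X] [NormedSpace ℝ X]
    (f : X → EReal) (x : X) : Set (X →L[ℝ] ℝ) :=
  {xs | x ∈ effDom f ∧ ∀ u, ((xs u : ℝ) : EReal) ≤ clarkeRockafellarSubderiv f x u}

/-- The weak*-controlled closure at `x` of a set-valued map `T`, relative to `f`: all `xs` for
which there is a net `(x_ν, xs_ν)` in the graph of `T` with `(x_ν, f (x_ν)) → (x, f x)`,
`xs_ν → xs` weak* (that is, pointwise) and `limsup_ν ⟨xs_ν, x_ν - x⟩ ≤ 0`. -/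
def controlledClosure {X : Type u} [NormedAddCommGroup X] [NormedSpace ℝ X]
    (f : X → EReal) (T : X → Set (X →L[ℝ] ℝ)) (x : X) : Set (X →L[ℝ] ℝ) :=
  {xs | ∃ (ι : Type u) (_ : Preorder ι) (_ : IsDirectedOrder ι) (_ : Nonempty ι)
      (y : ι → X) (ys : ι → X →L[ℝ] ℝ),
      (∀ ν, ys ν ∈ T (y ν)) ∧
      Tendsto (fun ν => (y ν, f (y ν))) atTop (𝓝 (x, f x)) ∧
      (∀ w, Tendsto (fun ν => ys ν w) atTop (𝓝 (xs w))) ∧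
      limsup (fun ν => ((ys ν (y ν - x) : ℝ) : EReal)) atTop ≤ 0}

/-- Convexity of an extended-real function: its epigraph is convex. -/
def IsConvexFn {X : Type u} [NormedAddCommGroup X] [NormedSpace ℝ X] (φ : X → EReal) : Prop :=
  Convex ℝ {p : X × ℝ | φ p.1 ≤ (p.2 : EReal)}

/-- `φ` is finite and Lipschitz on a neighbourhood of `x`. -/
def IsLipschitzNear {X : Type u} [NormedAddCommGroup X] (φ : X → EReal) (x : X) : Prop :=
  ∃ K : NNReal, ∃ U ∈ 𝓝 x, ∃ g : X → ℝ, (∀ y ∈ U, φ y = (g y : EReal)) ∧ LipschitzOnWith K g U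

/-- The Separation Principle in `X` for an operator `D` that associates a set-valued map
`D f : X ⇉ X*` to each function `f` on `X`. -/
def SeparationPrinciple {X : Type u} [NormedAddCommGroup X] [NormedSpace ℝ X]
    (D : (X → EReal) → X → Set (X →L[ℝ] ℝ)) : Prop :=
  ∀ (f φ : X → EReal) (x : X), IsProperLsc f → IsProperLsc φ → IsConvexFn φ →
    x ∈ effDom f → IsLipschitzNear φ x → IsLocalMin (fun y => f y + φ y) x →
    ∃ xs ∈ controlledClosure f (D f) x, ∃ zs ∈ D φ x, xs + zs = 0

/-- A subdifferential on `X`: an operator `D` with `∂_MR f ⊆ D f ⊆ ∂_C f` for all proper lsc `f`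
and with the Separation Principle. -/
structure IsSubdifferential {X : Type u} [NormedAddCommGroup X] [NormedSpace ℝ X]
    (D : (X → EReal) → X → Set (X →L[ℝ] ℝ)) : Prop where
  moreauRockafellar_subset : ∀ f, IsProperLsc f → ∀ x, moreauRockafellarSubdiff f x ⊆ D f x
  subset_clarke : ∀ f, IsProperLsc f → ∀ x, D f x ⊆ clarkeSubdiff f x
  separation : SeparationPrinciple D

/-- The support function `sup {⟨xs, u⟩ | xs ∈ S}`, with value `-∞` for empty `S`. The
subderivative associated to a subdifferential `∂` is
`f^∂(x; u) = supportFn (∂ f x) u`. -/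
def supportFn {X : Type u} [NormedAddCommGroup X] [NormedSpace ℝ X]
    (S : Set (X →L[ℝ] ℝ)) (u : X) : EReal :=
  ⨆ xs ∈ S, ((xs u : ℝ) : EReal)

/-- Directional convergence `y →_v x` from the direction `v`: `y = x + t v'` with `t ↘ 0` and
`v' → v`. The drops `{x + t v' | 0 < t < ε, v' ∈ B(v, ε)}`, `ε > 0`, form a basis. -/
def dirNhds {X : Type u} [NormedAddCommGroup X] [NormedSpace ℝ X] (x v : X) : Filter X :=
  map (fun p : ℝ × X => x + p.1 • p.2) (𝓝[>] 0 ×ˢ 𝓝 v)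

/-- `limsup_{y →_v x} F y` for a function `F` that matters on `dom f` only: the infimum over
`ε > 0` of the suprema of `F` over the points of `dom f` in the drop
`{x + t v' | 0 < t < ε, v' ∈ B(v, ε)}` (with `sup ∅ = -∞`). -/
def dirLimsup {X : Type u} [NormedAddCommGroup X] [NormedSpace ℝ X]
    (f : X → EReal) (x v : X) (F : X → EReal) : EReal :=
  limsup F (dirNhds x v ⊓ 𝓟 (effDom f))

end

/-! Pointwise, `f^d ≤ f^r`, `f^d ≤ f' ≤ f^↑` and `f^∂ ≤ f^↑`. Hence all the upper limits agree once,
after taking them, `f^↑` is bounded by `f^d` and `f^r` by `f^∂`. Drops are open, so for each of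
these two bounds it suffices to pass to nearby points: if `l < F(y; w)`, then arbitrarily close to
`y` there is `z ∈ dom f` with `l < G(z; w + α(y - z))`. For `w = u + α(x₀ - y)` the new direction is
`u + α(x₀ - z)`, so the family of directions is preserved.

From `f^↑` to `f^d` (`exists_lt_directionalSubderiv_of_lt_clarkeRockafellarSubderiv`): were `f^d` at
most `l` near `y`, short descents could be continued, by a maximality argument in a cone, to every
small time `t`, which bounds `f^↑` by any `l' > l`.

From `f^r` to `f^∂` (`exists_controlledClosure_of_lt_radialSubderiv`,
`exists_lt_supportFn_of_lt_radialSubderiv`): a lower bound on `f^r` puts `f` above an affine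
function on a segment. Penalizing the distance to that segment and applying Ekeland's principle
makes `f` plus a convex Lipschitz function minimal at a nearby point. The Separation Principle gives
a limiting subgradient there, and the control on its net allows replacing it by a true subgradient.
-/

/-! ### Maximality and Ekeland's principle. -/

/-- A maximality principle of Brezis-Browder type: a transitive relation on a complete metric space
whose sections are closed and which is controlled by a function bounded above has maximal
elements. -/
theorem exists_maximal_of_dist_le {E : Type*} [MetricSpace E] [CompleteSpace E]
    (R : E → E → Prop) (ψ : E → ℝ) (a : E)
    (hself : ∀ p q, R p q → R q q) (htrans : ∀ p q r, R p q → R q r → R p r)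
    (hdist : ∀ p q, R p q → dist p q ≤ ψ q - ψ p)
    (hclosed : ∀ p, IsClosed {q | R p q}) (B : ℝ) (hB : ∀ q, R a q → ψ q ≤ B) (ha : R a a) :
    ∃ b, R a b ∧ ∀ c, R b c → c = b := by
  -- Choosing `q` with `ψ q` almost maximal over the section of `p` forces the section of `q` to be
  -- small, by the control on distances.
  have step : ∀ (p : {p // R a p}) (n : ℕ), ∃ q : {p // R a p}, R p q ∧
      ∀ z, R q z → dist (q : E) z ≤ 1 / ((n : ℝ) + 1) := by
    rintro ⟨p, hp⟩ n
    set S : Set ℝ := ψ '' {q | R p q} with hS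
    have hne : S.Nonempty := ⟨ψ p, p, hself _ _ hp, rfl⟩
    have hbdd : BddAbove S := ⟨B, by
      rintro _ ⟨q, hq, rfl⟩
      exact hB q (htrans _ _ _ hp hq)⟩
    have hpos : (0 : ℝ) < 1 / ((n : ℝ) + 1) := by positivity
    obtain ⟨_, ⟨q, hq, rfl⟩, hlt⟩ := exists_lt_of_lt_csSup hne (sub_lt_self (sSup S) hpos)
    refine ⟨⟨q, htrans _ _ _ hp hq⟩, hq, fun z hz => ?_⟩
    have h1 := hdist _ _ hz
    have h2 : ψ z ≤ sSup S := le_csSup hbdd ⟨z, htrans _ _ _ hq hz, rfl⟩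
    simp only at h1 ⊢
    linarith
  choose next hnext hnear using step
  let s : ℕ → {p // R a p} := fun n => Nat.rec ⟨a, ha⟩ (fun n p => next p n) n
  have hs : ∀ n, s (n + 1) = next (s n) n := fun n => rfl
  have hmono : ∀ n m, n ≤ m → R (s n).1 (s m).1 := by
    intro n m h
    induction m, h using Nat.le_induction with
    | base => exact hself _ _ (s n).2
    | succ m _ ih => exact htrans _ _ _ ih (by rw [hs]; exact hnext _ _)
  have hsmall : ∀ n z, R (s (n + 1)) z → dist (s (n + 1) : E) z ≤ 1 / ((n : ℝ) + 1) := by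
    intro n z hz
    rw [hs] at hz ⊢
    exact hnear _ _ z hz
  have hlim0 : Tendsto (fun n : ℕ => 1 / ((n : ℝ) + 1)) atTop (𝓝 0) :=
    tendsto_one_div_add_atTop_nhds_zero_nat
  have hcauchy : CauchySeq (fun n => (s (n + 1) : E)) := by
    refine cauchySeq_of_le_tendsto_0' (fun n : ℕ => 1 / ((n : ℝ) + 1)) (fun n m h => ?_) hlim0
    exact hsmall n _ (hmono (n + 1) (m + 1) (by omega))
  obtain ⟨b, hb⟩ := cauchySeq_tendsto_of_complete hcauchy
  have hRb : ∀ n, R (s n).1 b := fun n =>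
    (hclosed (s n).1).mem_of_tendsto hb
      (eventually_atTop.2 ⟨n, fun m hm => hmono n (m + 1) (by omega)⟩)
  refine ⟨b, hRb 0, fun c hc => ?_⟩
  have hc' : Tendsto (fun n => (s (n + 1) : E)) atTop (𝓝 c) := by
    rw [tendsto_iff_dist_tendsto_zero]
    exact squeeze_zero (fun _ => dist_nonneg)
      (fun n => hsmall n c (htrans _ _ _ (hRb (n + 1)) hc)) hlim0
  exact tendsto_nhds_unique hc' hb

theorem LowerSemicontinuous.isClosed_le {Y Z : Type*} [TopologicalSpace Y] [TopologicalSpace Z]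
    {f : Y → EReal} (hf : LowerSemicontinuous f) {g : Z → Y} (hg : Continuous g) {r : Z → EReal}
    (hr : Continuous r) : IsClosed {z | f (g z) ≤ r z} :=
  (lowerSemicontinuous_iff_isClosed_epigraph.1 hf).preimage (hg.prodMk hr)

/-- Ekeland's variational principle on a closed set. -/
theorem exists_ekeland_point {Y : Type*} [MetricSpace Y] [CompleteSpace Y] {F : Y → EReal}
    (hF : LowerSemicontinuous F) {C : Set Y} (hC : IsClosed C) {m r ε : ℝ} (hε : 0 < ε)
    (hm : ∀ y ∈ C, (m : EReal) ≤ F y) {a : Y} (ha : a ∈ C) (hFa : F a ≤ r) :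
    ∃ z ∈ C, ε * dist a z ≤ r - m ∧ F z ≤ r ∧
      ∀ y ∈ C, F z ≤ F y + ((ε * dist z y : ℝ) : EReal) := by
  -- The Bishop-Phelps cone order on the epigraph: `F` is only lower semicontinuous, but the extra
  -- height coordinate makes the sections closed.
  let R : Y × ℝ → Y × ℝ → Prop := fun p q =>
    q.1 ∈ C ∧ F q.1 ≤ (q.2 : EReal) ∧ ε * dist p.1 q.1 ≤ p.2 - q.2
  have hle : ∀ p q, R p q → q.2 ≤ p.2 := by
    rintro p q ⟨-, -, h⟩
    nlinarith [dist_nonneg (x := p.1) (y := q.1)]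
  obtain ⟨⟨z, s⟩, ⟨hz, hFz, hd⟩, hmax⟩ := exists_maximal_of_dist_le R
    -- A height drop `d` bounds the move in `Y` by `d / ε` and the move in height by `d`; the factor
    -- `1 / ε + 1` dominates both.
    (fun p => -((1 / ε + 1) * p.2)) (a, r)
    (by rintro p q ⟨h1, h2, h3⟩; exact ⟨h1, h2, by simp⟩)
    (by
      rintro p q q' ⟨h1, h2, h3⟩ ⟨h4, h5, h6⟩
      refine ⟨h4, h5, ?_⟩
      have := mul_le_mul_of_nonneg_left (dist_triangle p.1 q.1 q'.1) hε.le
      linarith)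
    (by
      rintro p q h
      have h0 := hle p q h
      obtain ⟨-, -, h3⟩ := h
      have h4 : dist p.1 q.1 ≤ 1 / ε * (p.2 - q.2) := by
        rw [one_div, ← div_eq_inv_mul, le_div_iff₀ hε]; linarith
      have h5 : 0 ≤ 1 / ε * (p.2 - q.2) := mul_nonneg (by positivity) (by linarith)
      rw [Prod.dist_eq]
      refine max_le (by linarith) ?_
      rw [Real.dist_eq, abs_of_nonneg (by linarith)]
      linarith)
    (by
      intro p
      have h1 : IsClosed {q : Y × ℝ | ε * dist p.1 q.1 ≤ p.2 - q.2} :=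
        isClosed_le (by fun_prop) (by fun_prop)
      exact (hC.preimage continuous_fst).inter (IsClosed.inter
        (hF.isClosed_le continuous_fst (continuous_coe_real_ereal.comp continuous_snd)) h1))
    (-((1 / ε + 1) * m))
    (by
      rintro q ⟨h1, h2, -⟩
      have : m ≤ q.2 := EReal.coe_le_coe_iff.1 ((hm _ h1).trans h2)
      have h3 : 0 ≤ 1 / ε + 1 := by positivity
      have := mul_le_mul_of_nonneg_left this h3
      linarith)
    ⟨ha, hFa, by simp⟩
  simp only at hz hFz hd
  have hms : m ≤ s := EReal.coe_le_coe_iff.1 ((hm _ hz).trans hFz)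
  have hdn : 0 ≤ ε * dist a z := by positivity
  refine ⟨z, hz, by linarith, hFz.trans (EReal.coe_le_coe_iff.2 (by linarith)), fun y hy => ?_⟩
  by_contra! hlt
  have h1 : F y ≤ ((s - ε * dist z y : ℝ) : EReal) := by
    rw [EReal.coe_sub, EReal.le_sub_iff_add_le (by simp) (by simp)]
    exact hlt.le.trans hFz
  have h2 := hmax (y, s - ε * dist z y) ⟨hy, h1, by simp⟩
  have h3 : y = z := congrArg Prod.fst h2
  rw [h3] at hlt
  simp at hlt

theorem IsProperLsc.exists_coe_eq {X : Type u} [TopologicalSpace X] {f : X → EReal} (hf : IsProperLsc f) {x : X}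
    (hx : x ∈ effDom f) : ∃ r : ℝ, f x = r :=
  ⟨(f x).toReal, (EReal.coe_toReal (ne_of_lt hx) (hf.ne_bot x)).symm⟩

/-! ### Directional limits and comparison of subderivatives. -/

section Subderivatives

variable {X : Type u} [NormedAddCommGroup X] [NormedSpace ℝ X]

theorem diffQuot_le_iff {f : X → EReal} {x h : X} {r t l : ℝ} (hr : f x = r) (ht : 0 < t) :
    diffQuot f x t h ≤ (l : EReal) ↔ f (x + t • h) ≤ ((r + t * l : ℝ) : EReal) := by
  rw [diffQuot, hr, EReal.div_le_iff_le_mul (by exact_mod_cast ht) (EReal.coe_ne_top t),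
    EReal.sub_le_iff_le_add (by simp) (by simp), ← EReal.coe_mul, ← EReal.coe_add,
    add_comm (t * l)]

theorem diffQuot_lt_iff {f : X → EReal} {x h : X} {r t l : ℝ} (hr : f x = r) (ht : 0 < t) :
    diffQuot f x t h < (l : EReal) ↔ f (x + t • h) < ((r + t * l : ℝ) : EReal) := by
  rw [diffQuot, hr, EReal.div_lt_iff (by exact_mod_cast ht) (EReal.coe_ne_top t),
    ← EReal.coe_mul, EReal.sub_lt_iff (by simp) (by simp), ← EReal.coe_add,
    mul_comm l t, add_comm (t * l)]

theorem directionalSubderiv_le_radialSubderiv (f : X → EReal) (x h : X) :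
    directionalSubderiv f x h ≤ radialSubderiv f x h := by
  have ht : Tendsto (fun t : ℝ => (t, h)) (𝓝[>] 0) (𝓝[>] 0 ×ˢ 𝓝 h) :=
    tendsto_id.prodMk tendsto_const_nhds
  exact liminf_le_liminf_of_le ht

/-- Since `t > 0`, the point `z` near `x + t w` is `x + t w'` with `w' = (z - x) / t` close to `w`:
drops are open. -/
theorem eventually_dirNhds_eventually_nhds {x v : X} {P : X → Prop}
    (h : ∀ᶠ y in dirNhds x v, P y) : ∀ᶠ y in dirNhds x v, ∀ᶠ z in 𝓝 y, P z := by
  rw [dirNhds, eventually_map] at h ⊢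
  rw [eventually_prod_iff] at h
  obtain ⟨pa, hpa, pb, hpb, hP⟩ := h
  have h1 : ∀ᶠ t : ℝ in 𝓝[>] 0, pa t ∧ 0 < t := hpa.and self_mem_nhdsWithin
  refine (h1.prod_mk hpb.eventually_nhds).mono ?_
  rintro ⟨t, w⟩ ⟨⟨ht, ht0⟩, hw⟩
  have hcont : Tendsto (fun z : X => t⁻¹ • (z - x)) (𝓝 (x + t • w)) (𝓝 w) := by
    have : Continuous (fun z : X => t⁻¹ • (z - x)) := by fun_prop
    have h2 := this.tendsto (x + t • w)
    simpa [smul_smul, ht0.ne'] using h2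
  filter_upwards [hcont.eventually hw] with z hz
  have := hP ht hz
  simpa [smul_smul, ht0.ne'] using this

/-- Reduces a comparison of upper limits to a local one, in which the point may be perturbed;
openness of drops keeps the perturbed point admissible. -/
theorem dirLimsup_le_dirLimsup {f F G : X → EReal} {x v : X}
    (h : ∀ y ∈ effDom f, ∀ l : ℝ, (l : EReal) < F y → ∀ U ∈ 𝓝 y,
      ∃ z ∈ U, z ∈ effDom f ∧ (l : EReal) < G z) :
    dirLimsup f x v F ≤ dirLimsup f x v G := by
  refine le_of_forall_gt_imp_ge_of_dense fun a ha => ?_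
  have h1 := eventually_lt_of_limsup_lt ha
  rw [eventually_inf_principal] at h1
  refine limsup_le_of_le (h := ?_)
  rw [eventually_inf_principal]
  filter_upwards [eventually_dirNhds_eventually_nhds h1] with y hy hyd
  by_contra! hlt
  obtain ⟨l, hal, hl⟩ := EReal.lt_iff_exists_real_btwn.1 hlt
  obtain ⟨z, hzU, hzd, hz⟩ := h y hyd l hl _ hy
  exact lt_asymm (hal.trans hz) (hzU hzd)

theorem dirLimsup_mono {f F G : X → EReal} {x v : X} (h : ∀ y ∈ effDom f, F y ≤ G y) :
    dirLimsup f x v F ≤ dirLimsup f x v G :=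
  dirLimsup_le_dirLimsup fun y hy _ hl _ hU =>
    ⟨y, mem_of_mem_nhds hU, hy, hl.trans_le (h y hy)⟩

theorem supportFn_le_clarkeRockafellarSubderiv {S : Set (X →L[ℝ] ℝ)} {f : X → EReal} {x : X}
    (hS : S ⊆ clarkeSubdiff f x) (h : X) : supportFn S h ≤ clarkeRockafellarSubderiv f x h :=
  iSup₂_le fun _ hxs => (hS hxs).2 h

/-- If all directional subderivatives `f^d(z; w')`, for `z` near `y` and suitable `w'` near `w`,
are less than `l`, then one can move from `y` to some `y + t w'`, `w'` near `w`, while `f` grows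
with slope at most `l`. -/
theorem exists_le_of_directionalSubderiv_lt [CompleteSpace X] {f : X → EReal} (hf : IsProperLsc f)
    {y w : X} {r t l δ : ℝ} (hr : f y = r) (ht : 0 < t) (hδ : 0 < δ)
    (hslope : ∀ z ∈ effDom f, dist z y ≤ (δ + ‖w‖) * t →
      ∃ w' ∈ Metric.ball w δ, directionalSubderiv f z w' < (l : EReal)) :
    ∃ w' ∈ Metric.closedBall w δ, f (y + t • w') ≤ ((r + t * l : ℝ) : EReal) := by
  -- Pairs (time, position): motion stays in the cone of velocities within `δ` of `w`, time stops at
  -- `t`, and `f` stays below the line of slope `l`. A maximal pair must have time `t`, since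
  -- otherwise the slope hypothesis gives one more step.
  let R : ℝ × X → ℝ × X → Prop := fun p q =>
    q.1 ≤ t ∧ f q.2 ≤ ((r + l * q.1 : ℝ) : EReal) ∧
      ‖q.2 - p.2 - (q.1 - p.1) • w‖ ≤ δ * (q.1 - p.1)
  have hle : ∀ p q, R p q → p.1 ≤ q.1 := by
    rintro p q ⟨-, -, h⟩
    have := (norm_nonneg _).trans h
    nlinarith
  have hdist : ∀ p q, R p q → dist q.2 p.2 ≤ (δ + ‖w‖) * (q.1 - p.1) := by
    rintro p q h
    have h0 := hle p q h
    have h1 : q.2 - p.2 = (q.2 - p.2 - (q.1 - p.1) • w) + (q.1 - p.1) • w := by abel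
    rw [dist_eq_norm, h1]
    refine (norm_add_le _ _).trans ?_
    rw [norm_smul, Real.norm_eq_abs, abs_of_nonneg (by linarith)]
    linarith [h.2.2]
  obtain ⟨⟨s, z⟩, hsz, hmax⟩ := exists_maximal_of_dist_le R
    (fun p => (1 + δ + ‖w‖) * p.1) (0, y)
    (by rintro p q ⟨h1, h2, h3⟩; exact ⟨h1, h2, by simp⟩)
    (by
      rintro p q q' ⟨h1, h2, h3⟩ ⟨h4, h5, h6⟩
      refine ⟨h4, h5, ?_⟩
      have h7 : q'.2 - p.2 - (q'.1 - p.1) • w =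
          (q'.2 - q.2 - (q'.1 - q.1) • w) + (q.2 - p.2 - (q.1 - p.1) • w) := by module
      rw [h7]
      refine (norm_add_le _ _).trans ?_
      linarith)
    (by
      intro p q h
      have h0 := hle p q h
      have h1 := hdist p q h
      have h2 : 0 ≤ (δ + ‖w‖) * (q.1 - p.1) := dist_nonneg.trans h1
      rw [dist_comm, Prod.dist_eq]
      refine max_le ?_ (by linarith)
      rw [Real.dist_eq, abs_of_nonneg (by linarith)]
      linarith)
    (by
      intro p
      have h1 : IsClosed {q : ℝ × X | q.1 ≤ t} := isClosed_le (by fun_prop) (by fun_prop)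
      have h2 : IsClosed {q : ℝ × X | f q.2 ≤ ((r + l * q.1 : ℝ) : EReal)} :=
        hf.lsc.isClosed_le continuous_snd (continuous_coe_real_ereal.comp (by fun_prop))
      have h3 : IsClosed {q : ℝ × X | ‖q.2 - p.2 - (q.1 - p.1) • w‖ ≤ δ * (q.1 - p.1)} :=
        isClosed_le (by fun_prop) (by fun_prop)
      exact h1.inter (h2.inter h3))
    ((1 + δ + ‖w‖) * t)
    (fun q hq => mul_le_mul_of_nonneg_left hq.1 (by positivity))
    ⟨ht.le, by simp [hr], by simp⟩
  have hs0 := hle _ _ hsz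
  have hd := hdist _ _ hsz
  obtain ⟨hst, hfz, hn⟩ := hsz
  simp only [sub_zero] at hs0 hd hst hfz hn
  rcases hst.lt_or_eq with hlt | rfl
  · exfalso
    have hzd : z ∈ effDom f := lt_of_le_of_lt hfz (EReal.coe_lt_top _)
    obtain ⟨ρ, hρ⟩ := hf.exists_coe_eq hzd
    obtain ⟨w', hw', hdw⟩ := hslope z hzd
      (hd.trans (mul_le_mul_of_nonneg_left hst (by positivity)))
    have hfreq := frequently_lt_of_liminf_lt (h := hdw)
    have hev1 : ∀ᶠ h : ℝ in 𝓝[>] 0, h ∈ Set.Ioo 0 (t - s) := Ioo_mem_nhdsGT (by linarith)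
    have hev2 : ∀ᶠ h in 𝓝 w', h ∈ Metric.ball w δ := Metric.isOpen_ball.mem_nhds hw'
    have hev := hev1.prod_mk hev2
    obtain ⟨⟨h, w''⟩, hlt2, ⟨hh0, hht⟩, hw''⟩ := (hfreq.and_eventually hev).exists
    simp only at hlt2 hh0 hht hw''
    rw [diffQuot_lt_iff hρ hh0] at hlt2
    rw [hρ, EReal.coe_le_coe_iff] at hfz
    have := hmax (s + h, z + h • w'') ⟨by simp only; linarith, hlt2.le.trans
      (EReal.coe_le_coe_iff.2 (by simp only; linarith)), by
        rw [Metric.mem_ball, dist_eq_norm] at hw''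
        have : z + h • w'' - z - (s + h - s) • w = h • (w'' - w) := by module
        simp only
        rw [this, norm_smul, Real.norm_eq_abs, abs_of_pos hh0]
        nlinarith⟩
    have := congrArg Prod.fst this
    simp only at this
    linarith
  · refine ⟨s⁻¹ • (z - y), ?_, ?_⟩
    · rw [mem_closedBall_iff_norm]
      have : s⁻¹ • (z - y) - w = s⁻¹ • (z - y - s • w) := by
        rw [smul_sub _ _ (s • w), smul_smul, inv_mul_cancel₀ ht.ne', one_smul]
      rw [this, norm_smul, norm_inv, Real.norm_eq_abs, abs_of_pos ht, ← div_eq_inv_mul,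
        div_le_iff₀ ht]
      exact hn
    · rw [smul_smul, mul_inv_cancel₀ ht.ne', one_smul, add_sub_cancel, mul_comm s l]
      exact hfz

/-- Otherwise `f^d` is at most `l` near `x` in directions that lie within `δ` of `w`, and the
continuation lemma bounds the inner infimum of `f^↑` for small `t` and `y` near `x`. The
intermediate `l'` supplies the strict inequality that lemma needs. -/
theorem exists_lt_directionalSubderiv_of_lt_clarkeRockafellarSubderiv [CompleteSpace X]
    {f : X → EReal} (hf : IsProperLsc f) {x w : X} (hx : x ∈ effDom f) (α : ℝ) {l : ℝ}
    (hl : (l : EReal) < clarkeRockafellarSubderiv f x w) {U : Set X} (hU : U ∈ 𝓝 x) :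
    ∃ z ∈ U, z ∈ effDom f ∧ (l : EReal) < directionalSubderiv f z (w + α • (x - z)) := by
  by_contra! hcon
  obtain ⟨l', hll', hl'⟩ := EReal.lt_iff_exists_real_btwn.1 hl
  refine hl'.not_ge (iSup₂_le fun δ hδ => ?_)
  have hball : ∀ᶠ z in 𝓝 x, z ∈ U ∧ w + α • (x - z) ∈ Metric.ball w δ := by
    refine Filter.Eventually.and hU ?_
    have hc : Continuous (fun z : X => w + α • (x - z)) := by fun_prop
    refine hc.continuousAt.eventually (Metric.isOpen_ball.mem_nhds ?_)
    simpa using hδ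
  obtain ⟨ρ, hρ, hρU⟩ := Metric.eventually_nhds_iff.1 hball
  have hgraph : ∀ᶠ y in graphNhds f x, dist y x < ρ / 2 ∧ y ∈ effDom f := by
    have hmem : {p : X × EReal | dist p.1 x < ρ / 2 ∧ p.2 < ⊤} ∈ 𝓝 (x, f x) := by
      refine (IsOpen.and ?_ ?_).mem_nhds ⟨by simpa using hρ, hx⟩
      · exact isOpen_lt (by fun_prop) continuous_const
      · exact isOpen_lt continuous_snd continuous_const
    exact preimage_mem_comap hmem
  have ht : ∀ᶠ t : ℝ in 𝓝[>] 0, 0 < t ∧ (δ + ‖w‖) * t < ρ / 2 := by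
    refine Filter.Eventually.and self_mem_nhdsWithin (nhdsWithin_le_nhds ?_)
    have hc : Continuous (fun t : ℝ => (δ + ‖w‖) * t) := by fun_prop
    exact hc.continuousAt.eventually_lt_const (by simpa using hρ)
  refine limsup_le_of_le (h := (ht.prod_mk hgraph).mono ?_)
  rintro ⟨t, y⟩ ⟨⟨ht0, htρ⟩, hy, hyd⟩
  simp only at ht0 htρ hy hyd
  obtain ⟨r, hr⟩ := hf.exists_coe_eq hyd
  obtain ⟨w', hw', hle⟩ := exists_le_of_directionalSubderiv_lt hf (w := w) (l := l') hr ht0 hδ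
    (fun z hzd hz => by
      have hzx : dist z x < ρ := by linarith [dist_triangle z y x]
      obtain ⟨hzU, hzb⟩ := hρU hzx
      exact ⟨_, hzb, (hcon z hzU hzd).trans_lt hll'⟩)
  exact (iInf₂_le w' hw').trans ((diffQuot_le_iff hr ht0).2 hle)

end Subderivatives

/-! ### Convex functions, linear minorants and penalization. -/

theorem Convex.convexOn_infDist {X : Type*} [NormedAddCommGroup X] [NormedSpace ℝ X] {S : Set X}
    (hS : Convex ℝ S) (hne : S.Nonempty) :
    ConvexOn ℝ Set.univ (fun y => Metric.infDist y S) := by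
  refine ⟨convex_univ, fun x _ y _ a b ha hb hab => le_of_forall_pos_le_add fun ε hε => ?_⟩
  obtain ⟨p, hp, hxp⟩ := (Metric.infDist_lt_iff hne).1 (lt_add_of_pos_right (Metric.infDist x S) hε)
  obtain ⟨q, hq, hyq⟩ := (Metric.infDist_lt_iff hne).1 (lt_add_of_pos_right (Metric.infDist y S) hε)
  refine (Metric.infDist_le_dist_of_mem (hS hp hq ha hb hab)).trans ?_
  have h1 : a • x + b • y - (a • p + b • q) = a • (x - p) + b • (y - q) := by module
  rw [dist_eq_norm] at hxp hyq ⊢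
  rw [h1]
  refine (norm_add_le _ _).trans ?_
  rw [norm_smul, norm_smul, Real.norm_of_nonneg ha, Real.norm_of_nonneg hb]
  simp only [smul_eq_mul]
  calc a * ‖x - p‖ + b * ‖y - q‖
      ≤ a * (Metric.infDist x S + ε) + b * (Metric.infDist y S + ε) := by gcongr
    _ = a * Metric.infDist x S + b * Metric.infDist y S + (a + b) * ε := by ring
    _ = _ := by rw [hab, one_mul]

section Duality

variable {X : Type u} [NormedAddCommGroup X] [NormedSpace ℝ X]

/-- Clarke subgradients of a continuous convex function are subgradients. -/
theorem ConvexOn.le_sub_of_mem_clarkeSubdiff {g : X → ℝ} (hg : ConvexOn ℝ Set.univ g)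
    (hcont : Continuous g) {z : X} {xs : X →L[ℝ] ℝ}
    (hxs : xs ∈ clarkeSubdiff (fun y => (g y : EReal)) z) (h : X) :
    xs h ≤ g (z + h) - g z := by
  rw [← EReal.coe_le_coe_iff]
  refine (hxs.2 h).trans (iSup₂_le fun δ hδ => ?_)
  refine le_of_forall_gt_imp_ge_of_dense fun a ha => ?_
  obtain ⟨l, hl, hla⟩ := EReal.lt_iff_exists_real_btwn.1 ha
  rw [EReal.coe_lt_coe_iff] at hl
  refine le_trans ?_ hla.le
  have h1 : ∀ᶠ t : ℝ in 𝓝[>] 0, t ∈ Set.Ioo 0 1 := Ioo_mem_nhdsGT one_pos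
  have h2 : ∀ᶠ y in graphNhds (fun y => (g y : EReal)) z, g (y + h) - g y < l := by
    have hy : Tendsto (fun y : X => y) (graphNhds (fun y => (g y : EReal)) z) (𝓝 z) :=
      tendsto_fst.comp (tendsto_comap.mono_right nhds_prod_eq.le)
    have hc : Continuous fun y : X => g (y + h) - g y := by fun_prop
    exact hy.eventually (hc.continuousAt.eventually_lt_const hl)
  refine limsup_le_of_le (h := (h1.prod_mk h2).mono ?_)
  rintro ⟨t, y⟩ ⟨⟨ht0, ht1⟩, hy⟩
  simp only at ht0 ht1 hy
  refine (iInf₂_le h (Metric.mem_closedBall_self hδ.le)).trans ?_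
  rw [diffQuot_le_iff (f := fun y => (g y : EReal)) rfl ht0, EReal.coe_le_coe_iff]
  -- By convexity the difference quotient at step `t < 1` is at most the one at step `1`.
  have h3 := hg.2 (Set.mem_univ y) (Set.mem_univ (y + h)) (sub_nonneg.2 ht1.le) ht0.le
    (sub_add_cancel 1 t)
  have h4 : (1 - t) • y + t • (y + h) = y + t • h := by module
  rw [h4, smul_eq_mul, smul_eq_mul] at h3
  nlinarith

/-- A strict lower bound for the radial subderivative is realized by a linear functional which
minorizes `f` along a small segment. -/
theorem exists_linear_minorant_of_lt_radialSubderiv {f : X → EReal} {x w : X} {r l : ℝ}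
    (hr : f x = r) (hl : (l : EReal) < radialSubderiv f x w) :
    ∃ c : X →L[ℝ] ℝ, l < c w ∧ ∃ t₀ > 0, ∀ t ∈ Set.Icc (0 : ℝ) t₀,
      ((r + t * c w : ℝ) : EReal) ≤ f (x + t • w) := by
  obtain ⟨l', hll', hl'⟩ := EReal.lt_iff_exists_real_btwn.1 hl
  rw [EReal.coe_lt_coe_iff] at hll'
  have hev : ∀ᶠ t : ℝ in 𝓝[>] 0, ((r + t * l' : ℝ) : EReal) ≤ f (x + t • w) := by
    filter_upwards [eventually_lt_of_lt_liminf hl', self_mem_nhdsWithin] with t ht ht0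
    rw [← not_le, diffQuot_le_iff hr ht0, not_le] at ht
    exact ht.le
  obtain ⟨t₀, ht₀, hsub⟩ := mem_nhdsGT_iff_exists_Ioc_subset.1 hev
  by_cases hw : w = 0
  · have h1 : ((r + t₀ * l' : ℝ) : EReal) ≤ f (x + t₀ • w) := hsub ⟨ht₀, le_rfl⟩
    rw [hw, smul_zero, add_zero, hr, EReal.coe_le_coe_iff] at h1
    refine ⟨0, ?_, t₀, ht₀, fun t _ => ?_⟩
    · have h3 : 0 < t₀ := ht₀
      rw [zero_apply]
      nlinarith
    · simp [hw, hr]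
  · have hn : ‖w‖ ≠ 0 := norm_ne_zero_iff.2 hw
    obtain ⟨c, -, hc⟩ := exists_dual_vector ℝ w hn
    have hcw : ((l' / ‖w‖) • c) w = l' := by simp [hc, hn]
    refine ⟨(l' / ‖w‖) • c, by rwa [hcw], t₀, ht₀, fun t ht => ?_⟩
    rw [hcw]
    rcases ht.1.eq_or_lt with rfl | h0
    · simp [hr]
    · exact hsub ⟨h0, ht.2⟩

/-- Penalizing the distance to a compact set turns a lower bound on the set into an approximate
lower bound on a ball. -/
theorem exists_penalty {f : X → EReal} (hf : LowerSemicontinuous f) (c : X →L[ℝ] ℝ) {S : Set X}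
    (hS : IsCompact S) (hne : S.Nonempty) {x : X} {ρ m r σ : ℝ} (hσ : 0 < σ)
    (hm : ∀ y ∈ Metric.closedBall x ρ, (m : EReal) ≤ f y)
    (hSr : ∀ y ∈ S, ((r + c y : ℝ) : EReal) ≤ f y) :
    ∃ N : ℝ, 0 ≤ N ∧ ∀ y ∈ Metric.closedBall x ρ,
      ((r - σ : ℝ) : EReal) ≤ f y + ((N * Metric.infDist y S - c y : ℝ) : EReal) := by
  set V : Set X := {y | f y ≤ ((r - σ + c y : ℝ) : EReal)}ᶜ
  have hV : IsOpen V := (hf.isClosed_le continuous_id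
    (continuous_coe_real_ereal.comp (by fun_prop))).isOpen_compl
  have hSV : S ⊆ V := fun y hy => by
    refine not_le.2 (lt_of_lt_of_le ?_ (hSr y hy))
    exact EReal.coe_lt_coe_iff.2 (by linarith)
  -- Compactness gives a uniform tube around `S` where `f` is already large enough; outside it the
  -- distance is at least `γ`, so the penalty is at least `A`.
  obtain ⟨γ, hγ, hγV⟩ := hS.exists_thickening_subset_open hV hSV
  set A := |r - m| + |c x| + ‖c‖ * |ρ|
  have hA : 0 ≤ A := by positivity
  refine ⟨A / γ, by positivity, fun y hy => ?_⟩
  have hNn : 0 ≤ A / γ * Metric.infDist y S := mul_nonneg (by positivity) Metric.infDist_nonneg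
  rw [← EReal.sub_le_iff_le_add (.inl (EReal.coe_ne_bot _)) (.inl (EReal.coe_ne_top _)),
    ← EReal.coe_sub]
  by_cases hyd : Metric.infDist y S < γ
  · have hyV : y ∈ V := by
      obtain ⟨p, hp, hpy⟩ := (Metric.infDist_lt_iff hne).1 hyd
      exact hγV (Metric.mem_thickening_iff.2 ⟨p, hp, hpy⟩)
    refine le_trans ?_ (le_of_not_ge hyV)
    exact EReal.coe_le_coe_iff.2 (by linarith)
  · refine le_trans ?_ (hm y hy)
    have h1 : A ≤ A / γ * Metric.infDist y S := by
      rw [div_mul_eq_mul_div, le_div_iff₀ hγ]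
      exact mul_le_mul_of_nonneg_left (not_lt.1 hyd) hA
    have h2 : c y - c x ≤ ‖c‖ * |ρ| := by
      rw [← map_sub]
      refine (le_abs_self _).trans ((c.le_opNorm _).trans ?_)
      rw [← dist_eq_norm]
      exact mul_le_mul_of_nonneg_left ((Metric.mem_closedBall.1 hy).trans (le_abs_self ρ))
        (norm_nonneg c)
    refine EReal.coe_le_coe_iff.2 ?_
    linarith [le_abs_self (r - m), le_abs_self (c x)]

end Duality

/-! ### From the radial subderivative to subgradients. -/

section Duality

variable {X : Type u} [NormedAddCommGroup X] [NormedSpace ℝ X]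

/-- A point of a segment moves along `w + α (x - z)`, for a short time, without increasing its
distance to the segment issued from `x` in the direction `w`. -/
theorem exists_infDist_segment_le {x w z : X} {t₀ α : ℝ} (hα : 0 ≤ α) (ht₀ : 0 < t₀)
    (hz : w ≠ 0 → 2 * dist z x < t₀ * ‖w‖) :
    ∃ τ : ℝ, 0 < τ ∧ Metric.infDist (z + τ • (w + α • (x - z)))
        ((fun t : ℝ => x + t • w) '' Set.Icc 0 t₀) ≤
      Metric.infDist z ((fun t : ℝ => x + t • w) '' Set.Icc 0 t₀) := by
  set S := (fun t : ℝ => x + t • w) '' Set.Icc 0 t₀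
  have hS : IsCompact S := isCompact_Icc.image (by fun_prop)
  have hxS : x ∈ S := ⟨0, ⟨le_rfl, ht₀.le⟩, by simp⟩
  obtain ⟨s, hs0, hst, hs⟩ : ∃ s : ℝ, 0 ≤ s ∧ s < t₀ ∧
      Metric.infDist z S = dist z (x + s • w) := by
    obtain ⟨p, ⟨s, ⟨hs0, hst⟩, rfl⟩, hp⟩ := hS.exists_infDist_eq_dist ⟨x, hxS⟩ z
    by_cases hw : w = 0
    · exact ⟨0, le_rfl, ht₀, by simpa [hw] using hp⟩
    · refine ⟨s, hs0, ?_, hp⟩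
      have h1 : dist z (x + s • w) ≤ dist z x := hp ▸ Metric.infDist_le_dist_of_mem hxS
      have h2 : dist (x + s • w) x = s * ‖w‖ := by
        simp [norm_smul, abs_of_nonneg hs0]
      have h3 := dist_triangle_left (x + s • w) x z
      have h4 := hz hw
      exact lt_of_mul_lt_mul_right (by linarith) (norm_nonneg w)
  have hτ : ∃ τ : ℝ, 0 < τ ∧ τ * α ≤ 1 ∧ s + τ ≤ t₀ := by
    refine ⟨min (t₀ - s) (1 / (α + 1)), lt_min (by linarith) (by positivity), ?_, ?_⟩
    · refine (mul_le_mul_of_nonneg_right (min_le_right _ _) hα).trans ?_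
      rw [div_mul_eq_mul_div, div_le_one (by linarith)]
      linarith
    · linarith [min_le_left (t₀ - s) (1 / (α + 1))]
  obtain ⟨τ, hτ0, hτα, hτs⟩ := hτ
  refine ⟨τ, hτ0, ?_⟩
  have h0 : 0 ≤ 1 - τ * α := sub_nonneg.2 hτα
  have h01 : 1 - τ * α ≤ 1 := by nlinarith
  -- The move contracts towards `x` by `1 - τ α` and shifts by `τ w`. Applied to the nearest point
  -- `x + s w`, it gives this point, still in the segment because `s + τ ≤ t₀`.
  have hmem : x + ((1 - τ * α) * s + τ) • w ∈ S :=
    ⟨(1 - τ * α) * s + τ, ⟨by positivity, by nlinarith⟩, rfl⟩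
  refine (Metric.infDist_le_dist_of_mem hmem).trans ?_
  rw [hs, dist_eq_norm, dist_eq_norm]
  have h1 : z + τ • (w + α • (x - z)) - (x + ((1 - τ * α) * s + τ) • w) =
      (1 - τ * α) • (z - (x + s • w)) := by module
  rw [h1, norm_smul, Real.norm_of_nonneg h0]
  exact mul_le_of_le_one_left (norm_nonneg _) h01

/-- At the penalized minimum `z`, separation makes the negative of the limiting subgradient a
subgradient of the convex term. Along `w + α (x - z)` the distance penalty does not increase
initially, so however large `N` is, only `c` and the small Ekeland term contribute. -/
theorem exists_controlledClosure_of_lt_radialSubderiv [CompleteSpace X]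
    {D : (X → EReal) → X → Set (X →L[ℝ] ℝ)} (hD : IsSubdifferential D)
    {f : X → EReal} (hf : IsProperLsc f) {x w : X} (hx : x ∈ effDom f) {α : ℝ} (hα : 0 ≤ α)
    {l : ℝ} (hl : (l : EReal) < radialSubderiv f x w) {U : Set X} (hU : U ∈ 𝓝 x) :
    ∃ z ∈ U, z ∈ effDom f ∧ ∃ zs ∈ controlledClosure f (D f) z, l < zs (w + α • (x - z)) := by
  obtain ⟨r, hr⟩ := hf.exists_coe_eq hx
  obtain ⟨c, hlc, t₀, ht₀, hc⟩ := exists_linear_minorant_of_lt_radialSubderiv hr hl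
  set S : Set X := (fun t : ℝ => x + t • w) '' Set.Icc 0 t₀
  have hScomp : IsCompact S := isCompact_Icc.image (by fun_prop)
  have hxS : x ∈ S := ⟨0, ⟨le_rfl, ht₀.le⟩, by simp⟩
  have hSconv : Convex ℝ S := by
    have h := (convex_Icc (0 : ℝ) t₀).affine_image (AffineMap.lineMap x (x + w))
    have h2 : S = (AffineMap.lineMap x (x + w) : ℝ →ᵃ[ℝ] X) '' Set.Icc 0 t₀ := by
      refine Set.image_congr fun t _ => ?_
      simp [AffineMap.lineMap_apply, add_comm]
    rw [h2]
    exact h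
  have hrx : ((r - 1 : ℝ) : EReal) < f x := by
    rw [hr, EReal.coe_lt_coe_iff]
    linarith
  have hnear : ∀ᶠ y in 𝓝 x, y ∈ U ∧ ((r - 1 : ℝ) : EReal) < f y :=
    Filter.Eventually.and hU (hf.lsc x _ hrx)
  obtain ⟨ρ, hρ, hball⟩ := Metric.nhds_basis_closedBall.eventually_iff.1 hnear
  -- The last condition is the final estimate: `α ‖c‖ η` is the loss from replacing `w` by `w + α (x
  -- - z)` in `c`, and `η (‖w‖ + α η)` is the Ekeland term. The third puts `z` near enough to `x`
  -- that its nearest segment point can be moved on.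
  obtain ⟨η, hη0, hηρ, hηw, hηl⟩ : ∃ η : ℝ, 0 < η ∧ η < ρ ∧ (w ≠ 0 → 2 * η < t₀ * ‖w‖) ∧
      l < c w - α * ‖c‖ * η - η * (‖w‖ + α * η) := by
    have h1 : ∀ᶠ η : ℝ in 𝓝[>] 0, η ∈ Set.Ioo 0 ρ := Ioo_mem_nhdsGT hρ
    have h2 : ∀ᶠ η : ℝ in 𝓝[>] 0, w ≠ 0 → 2 * η < t₀ * ‖w‖ := by
      by_cases hw : w = 0
      · simp [hw]
      · have : 0 < t₀ * ‖w‖ / 2 := by have := norm_pos_iff.2 hw; positivity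
        filter_upwards [Ioo_mem_nhdsGT this] with η hη _
        linarith [hη.2]
    have h3 : ∀ᶠ η : ℝ in 𝓝[>] 0, l < c w - α * ‖c‖ * η - η * (‖w‖ + α * η) := by
      refine nhdsWithin_le_nhds ?_
      have hcont : Continuous fun η : ℝ => c w - α * ‖c‖ * η - η * (‖w‖ + α * η) := by fun_prop
      exact hcont.continuousAt.eventually_const_lt (by simpa using hlc)
    obtain ⟨η, ⟨h4, h5⟩, h6, h7⟩ := (h1.and (h2.and h3)).exists
    exact ⟨η, h4, h5, h6, h7⟩
  -- With gap `η * η` and Ekeland slope `η`, the new point is at distance at most `η` from `x`.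
  obtain ⟨N, hN, hpen⟩ := exists_penalty hf.lsc c hScomp ⟨x, hxS⟩ (x := x) (ρ := ρ) (m := r - 1)
    (r := r - c x) (σ := η * η) (mul_pos hη0 hη0) (fun y hy => (hball hy).2.le)
    (by
      rintro _ ⟨t, ht, rfl⟩
      refine le_trans (EReal.coe_le_coe_iff.2 (le_of_eq ?_)) (hc t ht)
      simp only [map_add, map_smul, smul_eq_mul]
      ring)
  set g : X → ℝ := fun y => N * Metric.infDist y S - c y
  have hgc : Continuous g := by fun_prop
  have hFlsc : LowerSemicontinuous fun y => f y + (g y : EReal) := by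
    refine hf.lsc.add' (continuous_coe_real_ereal.comp hgc).lowerSemicontinuous fun y => ?_
    exact EReal.continuousAt_add (by simp) (by simp)
  obtain ⟨z, -, hzd, hFz, hmin⟩ := exists_ekeland_point hFlsc
    (Metric.isClosed_closedBall (x := x) (ε := ρ)) (r := r - c x) hη0 hpen
    (Metric.mem_closedBall_self hρ.le)
    (by rw [hr, ← EReal.coe_add, EReal.coe_le_coe_iff]
        simp [g, Metric.infDist_zero_of_mem hxS, sub_eq_add_neg])
  have hzx : dist z x ≤ η := by
    rw [dist_comm]
    exact le_of_mul_le_mul_left (by linarith) hη0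
  have hzdom : z ∈ effDom f := by
    refine lt_top_iff_ne_top.2 fun h : f z = ⊤ => ?_
    rw [h, EReal.top_add_coe, top_le_iff] at hFz
    exact EReal.coe_ne_top _ hFz
  set φ : X → ℝ := fun y => g y + η * dist y z
  have hφc : Continuous φ := by fun_prop
  have hgconv : ConvexOn ℝ Set.univ g :=
    ((hSconv.convexOn_infDist ⟨x, hxS⟩).smul hN).sub (c.toLinearMap.concaveOn convex_univ)
  have hφconv : ConvexOn ℝ Set.univ φ := hgconv.add ((convexOn_univ_dist z).smul hη0.le)
  have hφproper : IsProperLsc fun y => (φ y : EReal) :=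
    ⟨fun y => EReal.coe_ne_bot _, ⟨x, EReal.coe_lt_top _⟩,
      (continuous_coe_real_ereal.comp hφc).lowerSemicontinuous⟩
  have hφconvE : IsConvexFn fun y => (φ y : EReal) := by
    have := hφconv.convex_epigraph
    simpa [IsConvexFn] using this
  have hφlip : IsLipschitzNear (fun y => (φ y : EReal)) z := by
    obtain ⟨K, hK⟩ : ∃ K : NNReal, (K : ℝ) = N + ‖c‖ + η := ⟨⟨_, by positivity⟩, rfl⟩
    have h1 : LipschitzWith K φ := by
      refine LipschitzWith.of_le_add_mul _ fun y y' => ?_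
      have h2 := mul_le_mul_of_nonneg_left
        (Metric.infDist_le_infDist_add_dist (s := S) (x := y) (y := y')) hN
      have h3 : c (y' - y) ≤ ‖c‖ * dist y y' := by
        rw [dist_comm, dist_eq_norm]
        exact (le_abs_self _).trans (c.le_opNorm _)
      have h4 := mul_le_mul_of_nonneg_left (dist_triangle y y' z) hη0.le
      rw [map_sub] at h3
      simp only [φ, g, hK]
      linarith
    exact ⟨_, Set.univ, univ_mem, φ, fun _ _ => rfl, h1.lipschitzOnWith⟩
  have hloc : IsLocalMin (fun y => f y + (φ y : EReal)) z := by
    have hb : Metric.ball x ρ ∈ 𝓝 z := Metric.isOpen_ball.mem_nhds (hzx.trans_lt hηρ)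
    filter_upwards [hb] with y hy
    have := hmin y (Metric.ball_subset_closedBall hy)
    simpa [φ, add_assoc, dist_comm] using this
  obtain ⟨zs, hzs, ys, hys, hsum⟩ := hD.separation f (fun y => (φ y : EReal)) z hf hφproper hφconvE
    hzdom hφlip hloc
  refine ⟨z, (hball (hzx.trans hηρ.le)).1, hzdom, zs, hzs, ?_⟩
  obtain ⟨τ, hτ, hdist⟩ := exists_infDist_segment_le (x := x) (w := w) (z := z) hα ht₀
    (fun hw => by linarith [hηw hw])
  set k := w + α • (x - z)
  have h1 := hφconv.le_sub_of_mem_clarkeSubdiff hφc (hD.subset_clarke _ hφproper z hys) (τ • k)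
  have h2 : zs k = - ys k := by
    have := congrArg (fun q : X →L[ℝ] ℝ => q k) hsum
    simp only [add_apply, zero_apply] at this
    linarith
  have hkn : ‖k‖ ≤ ‖w‖ + α * η := by
    refine (norm_add_le _ _).trans ?_
    rw [norm_smul, Real.norm_of_nonneg hα, ← dist_eq_norm, dist_comm]
    gcongr
  have hck : c w - α * ‖c‖ * η ≤ c k := by
    have h3 : c k = c w + α * c (x - z) := by simp [k]
    have h4 : -(‖c‖ * η) ≤ c (x - z) := by
      refine neg_le_of_abs_le ((c.le_opNorm _).trans ?_)
      rw [← dist_eq_norm, dist_comm]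
      gcongr
    nlinarith
  have h5 : φ (z + τ • k) - φ z ≤ τ * (η * ‖k‖ - c k) := by
    have h6 := mul_le_mul_of_nonneg_left hdist hN
    have h7 : dist (z + τ • k) z = τ * ‖k‖ := by simp [norm_smul, abs_of_pos hτ]
    simp only [φ, g, h7, dist_self, map_add, map_smul, smul_eq_mul]
    linarith
  have h8 : τ * ys k ≤ τ * (η * ‖k‖ - c k) := by
    rw [map_smul, smul_eq_mul] at h1
    exact h1.trans h5
  have h9 := le_of_mul_le_mul_left h8 hτ
  have h10 := mul_le_mul_of_nonneg_left hkn hη0.le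
  linarith

/-- Passing from `z` to `y ν` in the direction costs `α ⟨ys ν, y ν - z⟩`, a product that weak*
convergence alone would not control; the limsup condition and `α ≥ 0` make this cost small. -/
theorem exists_lt_supportFn_of_lt_radialSubderiv [CompleteSpace X]
    {D : (X → EReal) → X → Set (X →L[ℝ] ℝ)} (hD : IsSubdifferential D)
    {f : X → EReal} (hf : IsProperLsc f) {x w : X} (hx : x ∈ effDom f) {α : ℝ} (hα : 0 ≤ α)
    {l : ℝ} (hl : (l : EReal) < radialSubderiv f x w) {U : Set X} (hU : U ∈ 𝓝 x) :
    ∃ z ∈ U, z ∈ effDom f ∧ (l : EReal) < supportFn (D f z) (w + α • (x - z)) := by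
  obtain ⟨z, hzU, -, zs, ⟨ι, _, _, _, y, ys, hys, hy, hlim, hsup⟩, hlt⟩ :=
    exists_controlledClosure_of_lt_radialSubderiv hD hf hx hα hl (interior_mem_nhds.2 hU)
  set κ := zs (w + α • (x - z)) - l
  have hκ : 0 < κ := sub_pos.2 hlt
  have h1 : ∀ᶠ ν in atTop, y ν ∈ interior U :=
    ((continuous_fst.tendsto _).comp hy).eventually (isOpen_interior.mem_nhds hzU)
  have h2 : ∀ᶠ ν in atTop, l + κ / 2 < ys ν (w + α • (x - z)) :=
    (hlim _).eventually_const_lt (by simp only [κ] at hκ ⊢; linarith)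
  have h3 : ∀ᶠ ν in atTop, ys ν (y ν - z) < κ / (2 * (α + 1)) := by
    have hpos : 0 < κ / (2 * (α + 1)) := by positivity
    filter_upwards [eventually_lt_of_limsup_lt (hsup.trans_lt (EReal.coe_pos.2 hpos))] with ν hν
    exact EReal.coe_lt_coe_iff.1 hν
  obtain ⟨ν, hν1, hν2, hν3⟩ := (h1.and (h2.and h3)).exists
  refine ⟨y ν, interior_subset hν1, (hD.subset_clarke f hf _ (hys ν)).1, ?_⟩
  refine lt_of_lt_of_le (EReal.coe_lt_coe_iff.2 ?_) (le_iSup₂_of_le (ys ν) (hys ν) le_rfl)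
  have h4 : w + α • (x - y ν) = w + α • (x - z) - α • (y ν - z) := by module
  have h5 : α * ys ν (y ν - z) ≤ κ / 2 := by
    refine (mul_le_mul_of_nonneg_left hν3.le hα).trans ?_
    rw [← mul_div_assoc, div_le_div_iff₀ (by positivity) two_pos]
    nlinarith
  rw [h4, map_sub, map_smul, smul_eq_mul]
  linarith

end Duality

/-! ### The cycle of inequalities. -/

theorem theorem4p1 {X : Type u} [NormedAddCommGroup X] [NormedSpace ℝ X] [CompleteSpace X]
    (D : (X → EReal) → X → Set (X →L[ℝ] ℝ)) (hD : IsSubdifferential D)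
    (f : X → EReal) (hf : IsProperLsc f)
    (f' : X → X → EReal)
    (hf' : ∀ x ∈ effDom f, ∀ w : X,
      directionalSubderiv f x w ≤ f' x w ∧ f' x w ≤ clarkeRockafellarSubderiv f x w)
    (x₀ : X) (hx₀ : x₀ ∈ effDom f) (u v : X) (α : ℝ) (hα : 0 ≤ α) :
    dirLimsup f x₀ v (fun x => radialSubderiv f x (u + α • (x₀ - x))) =
        dirLimsup f x₀ v (fun x => f' x (u + α • (x₀ - x))) ∧
      dirLimsup f x₀ v (fun x => f' x (u + α • (x₀ - x))) =
        dirLimsup f x₀ v (fun x => supportFn (D f x) (u + α • (x₀ - x))) := by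
  have hshift : ∀ y z : X, u + α • (x₀ - y) + α • (y - z) = u + α • (x₀ - z) := by
    intro y z
    module
  have hCd : dirLimsup f x₀ v (fun x => clarkeRockafellarSubderiv f x (u + α • (x₀ - x))) ≤
      dirLimsup f x₀ v (fun x => directionalSubderiv f x (u + α • (x₀ - x))) :=
    dirLimsup_le_dirLimsup fun y hy l hl U hU => by
      obtain ⟨z, hzU, hz, h⟩ :=
        exists_lt_directionalSubderiv_of_lt_clarkeRockafellarSubderiv hf hy α hl hU
      exact ⟨z, hzU, hz, by rwa [hshift] at h⟩
  have hrD : dirLimsup f x₀ v (fun x => radialSubderiv f x (u + α • (x₀ - x))) ≤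
      dirLimsup f x₀ v (fun x => supportFn (D f x) (u + α • (x₀ - x))) :=
    dirLimsup_le_dirLimsup fun y hy l hl U hU => by
      obtain ⟨z, hzU, hz, h⟩ := exists_lt_supportFn_of_lt_radialSubderiv hD hf hy hα hl hU
      exact ⟨z, hzU, hz, by rwa [hshift] at h⟩
  have hdr : dirLimsup f x₀ v (fun x => directionalSubderiv f x (u + α • (x₀ - x))) ≤
      dirLimsup f x₀ v (fun x => radialSubderiv f x (u + α • (x₀ - x))) :=
    dirLimsup_mono fun y _ => directionalSubderiv_le_radialSubderiv f y _
  have hdf' : dirLimsup f x₀ v (fun x => directionalSubderiv f x (u + α • (x₀ - x))) ≤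
      dirLimsup f x₀ v (fun x => f' x (u + α • (x₀ - x))) :=
    dirLimsup_mono fun y hy => (hf' y hy _).1
  have hf'C : dirLimsup f x₀ v (fun x => f' x (u + α • (x₀ - x))) ≤
      dirLimsup f x₀ v (fun x => clarkeRockafellarSubderiv f x (u + α • (x₀ - x))) :=
    dirLimsup_mono fun y hy => (hf' y hy _).2
  have hDC : dirLimsup f x₀ v (fun x => supportFn (D f x) (u + α • (x₀ - x))) ≤
      dirLimsup f x₀ v (fun x => clarkeRockafellarSubderiv f x (u + α • (x₀ - x))) :=
    dirLimsup_mono fun y _ => supportFn_le_clarkeRockafellarSubderiv (hD.subset_clarke f hf y) _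
  exact ⟨le_antisymm (hrD.trans (hDC.trans (hCd.trans hdf'))) (hf'C.trans (hCd.trans hdr)),
    le_antisymm (hf'C.trans (hCd.trans (hdr.trans hrD))) (hDC.trans (hCd.trans hdf'))⟩
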